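/- Notation. For $r\in\mathbb N$ let $\mathcal F([1,r])$ be the set of all subsets of $[1,r]=\{1,\dots,r\}$, let $[x]$ be the integer part (floor) of $x\in\mathbb R$, and let $\|x\|=\operatorname{dist}(x,\mathbb Z)$. For $\phi\colon\mathcal F([1,r])\to\mathbb R$ and $\beta\subseteq[1,r]$ put $D_\beta\phi(\alpha)=\phi(\alpha\cup\beta)-\phi(\alpha)$ for $\alpha\subseteq[1,r]\setminus\beta$. The mapping $\phi$ is a *polynomial mapping of degree $\le d$* if $D_{\beta_d}\cdots D_{\beta_0}\phi=0$ (on subsets of $[1,r]\setminus\bigcup_i\beta_i$) for all pairwise disjoint $\beta_0,\dots,\beta_d\subseteq[1,r]$; its degree is the least such $d$; it is *constant-free* if $\phi(\varnothing)=0$. A *generalized polynomial mapping* is a mapping $\phi\colon\mathcal F([1,r])\to\mathbb R$ given by an expression (a *representation* of $\phi$) built from polynomial mappings by addition, negation, multiplication and taking the integer part. A representation is *constant-free* if all polynomial mappings occurring in it are constant-free; it has *total degree $\le D$* if the degrees of all polynomial mappings occurring in it (counted with multiplicity) add up to at most $D$; it is *open* if, when it is multiplied out with the brackets $[\psi]$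 treated as indeterminates, no closed summand $\pm[\psi_1]\cdots[\psi_l]$ (one without a polynomial factor) remains. We say that $\phi$ is open, constant-free and of total degree $\le D$ if it has one representation with these three properties. For $d,h,w\ge 0$, the classes $\mathrm{GPol}^0_{d,h,w}([1,r],\mathbb R)$ of open constant-free generalized polynomial mappings of degree $\le d$, height $\le h$ and width $\le w$ are defined recursively: $\phi\in\mathrm{GPol}^0_{d,h,w}$ if either $w\ge1$ and $\phi$ is a constant-free polynomial mapping of degree $\le d$, or $h\ge 1$ and $\phi=\sum_{j=1}^m[\phi_{j,1}]\cdots[\phi_{j,l_j}]\,\phi_{j,0}$, where $\sum_{j=1}^m(l_j+1)\le w$, each $\phi_{j,0}$ is a constant-free polynomial mapping of degree $\le d_{j,0}$, each $\phi_{j,t}$ with $t\ge1$ belongs to $\mathrm{GPol}^0_{d_{j,t},h-1,w}$, and $\sum_{t=0}^{l_j}d_{j,t}\le d$ for every $j$. Theorem. (1) For any $D\in\mathbb N$ and $\varepsilon>0$ there exists $r=r(D,\varepsilon)\in\mathbb N$ such that for any open constant-free generalized polynomial mapping $\phi\colon\mathcal F([1,r])\to\mathbb R$ of total degree $\le D$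 there exists a nonempty $\alpha\subseteq[1,r]$ with $\|\phi(\alpha)\|<\varepsilon$. (2) For any $k,d,h,w\in\mathbb N$ and $\varepsilon>0$ there exists $r=r(k,d,h,w,\varepsilon)\in\mathbb N$ such that for any $\phi_1,\dots,\phi_k\in\mathrm{GPol}^0_{d,h,w}([1,r],\mathbb R)$ there exists a nonempty $\alpha\subseteq[1,r]$ with $\|\phi_i(\alpha)\|<\varepsilon$ for all $i=1,\dots,k$. -/

import Mathlib

open scoped BigOperators

noncomputable section

namespace GenPoly

universe u v

section Polynomial

variable {A : Type u} [DecidableEq A] {H : Type v} [AddCommGroup H]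

/-- The `β`-derivative of a mapping `φ` on the finite subsets of `A`. Only its values at sets `α`
disjoint from `β` are ever used. -/
def setDeriv (β : Finset A) (φ : Finset A → H) : Finset A → H :=
  fun α => φ (α ∪ β) - φ α

/-- The iterated derivative: for the list `[β₀, β₁, …, βₙ]` it is `D_{βₙ} ⋯ D_{β₁} D_{β₀} φ`. -/
def iterDeriv : List (Finset A) → (Finset A → H) → (Finset A → H)
  | [], φ => φ
  | β :: L, φ => iterDeriv L (setDeriv β φ)

/-- `φ` is a polynomial mapping of degree `≤ d`: for any `d + 1` pairwise disjoint finite sets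
`β₀, …, β_d`, the mapping `D_{β_d} ⋯ D_{β₀} φ` vanishes on its domain, which consists of the finite
sets disjoint from all the `βᵢ`. -/
def IsPolyMap (d : ℕ) (φ : Finset A → H) : Prop :=
  ∀ L : List (Finset A), L.length = d + 1 → L.Pairwise Disjoint →
    ∀ α : Finset A, (∀ β ∈ L, Disjoint α β) → iterDeriv L φ α = 0

/-- A (conventional) polynomial mapping: polynomial of degree `≤ d` for some `d`. -/
def IsPolynomial (φ : Finset A → H) : Prop := ∃ d : ℕ, IsPolyMap d φ

/-- The degree of a polynomial mapping: the least `d` such that it is polynomial of degree `≤ d`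
(so the zero mapping gets degree `0`). -/
def polyDegree (φ : Finset A → H) : ℕ := sInf {d : ℕ | IsPolyMap d φ}

/-- Polynomial mappings of degree `≤ d` with zero constant term. -/
def IsPolyMapZero (d : ℕ) (φ : Finset A → H) : Prop := IsPolyMap d φ ∧ φ ∅ = 0

end Polynomial

/-- The distance from a real number to the nearest integer. -/
def distInt (x : ℝ) : ℝ := Metric.infDist x (Set.range ((↑) : ℤ → ℝ))

section Representations

variable (A : Type u) [DecidableEq A]

/-- Representations of generalized polynomial mappings on the finite subsets of `A`: expressions
built from conventional real-valued polynomial mappings by the ring operations and by taking the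
integer part. -/
inductive Rep : Type u
  | poly (p : Finset A → ℝ) (hp : IsPolynomial p) : Rep
  | add (e f : Rep) : Rep
  | neg (e : Rep) : Rep
  | mul (e f : Rep) : Rep
  | floor (e : Rep) : Rep

end Representations

namespace Rep

variable {A : Type u} [DecidableEq A]

/-- The mapping represented by an expression. -/
def eval : Rep A → Finset A → ℝ
  | poly p _, α => p α
  | add e f, α => eval e α + eval f α
  | neg e, α => - eval e α
  | mul e f, α => eval e α * eval f α
  | floor e, α => ((⌊eval e α⌋ : ℤ) : ℝ)

/-- All the conventional polynomial mappings of the expression vanish at `∅`. -/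
def ConstantFree : Rep A → Prop
  | poly p _ => p ∅ = 0
  | add e f => ConstantFree e ∧ ConstantFree f
  | neg e => ConstantFree e
  | mul e f => ConstantFree e ∧ ConstantFree f
  | floor e => ConstantFree e

/-- The total degree: the sum of the degrees of all (occurrences of) the conventional polynomial
mappings of the expression. -/
def totalDegree : Rep A → ℕ
  | poly p _ => polyDegree p
  | add e f => totalDegree e + totalDegree f
  | neg e => totalDegree e
  | mul e f => totalDegree e + totalDegree f
  | floor e => totalDegree e

/-- The closed part of an expression: multiply the expression out, treating the brackets `[ψ]` as
indeterminates `X ψ`, and keep only the summands `± [ψ₁] ⋯ [ψₖ]` without a conventional polynomial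
factor. In other words, the image of the expression modulo the ideal generated by the
conventional polynomials. -/
def closedPart : Rep A → MvPolynomial (Finset A → ℝ) ℤ
  | poly _ _ => 0
  | add e f => closedPart e + closedPart f
  | neg e => - closedPart e
  | mul e f => closedPart e * closedPart f
  | floor e => MvPolynomial.X (eval e)

/-- The expression lies in the ideal generated by the conventional polynomials, that is, it has no
closed summands `[ψ₁] ⋯ [ψₖ]`. -/
def IsOpen (e : Rep A) : Prop := closedPart e = 0

end Rep

section GPol

variable {A : Type u} [DecidableEq A]

/-- `φ` is an open constant-free generalized polynomial mapping of total degree `≤ D`: it has a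
representation with these properties. -/
def IsOpenConstantFreeOfTotalDegreeLE (D : ℕ) (φ : Finset A → ℝ) : Prop :=
  ∃ e : Rep A, e.eval = φ ∧ e.ConstantFree ∧ e.IsOpen ∧ e.totalDegree ≤ D

/-- `IsGPolZero d h w φ`: `φ` is an open constant-free generalized polynomial mapping of degree
`≤ d`, height `≤ h` and width `≤ w`. Either `φ` is a conventional polynomial mapping with zero
constant term (which has height `0` and width `1`), or
`φ = ∑_{j < m} [ψ_{j,1}] ⋯ [ψ_{j,l_j}] ψ_{j,0}`
where the `ψ_{j,0}` are conventional polynomial mappings with zero constant term, the `ψ_{j,t}`,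
`t ≥ 1`, are open constant-free generalized polynomial mappings of height one less and width
`≤ w`, the degrees in each summand add up to at most `d`, and `∑_j (l_j + 1) ≤ w`. -/
inductive IsGPolZero : ℕ → ℕ → ℕ → (Finset A → ℝ) → Prop
  | poly {d h w : ℕ} {φ : Finset A → ℝ} (hw : 1 ≤ w) (hφ : IsPolyMapZero d φ) :
      IsGPolZero d h w φ
  | sum {d h w : ℕ} {φ : Finset A → ℝ} (m : ℕ) (l : Fin m → ℕ)
      (ψ₀ : Fin m → Finset A → ℝ) (ψ : (j : Fin m) → Fin (l j) → Finset A → ℝ)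
      (e₀ : Fin m → ℕ) (e : (j : Fin m) → Fin (l j) → ℕ)
      (hψ₀ : ∀ j, IsPolyMapZero (e₀ j) (ψ₀ j))
      (hψ : ∀ j t, IsGPolZero (e j t) h w (ψ j t))
      (hdeg : ∀ j, e₀ j + ∑ t, e j t ≤ d)
      (hwidth : ∑ j, (l j + 1) ≤ w)
      (hφ : ∀ α, φ α = ∑ j, (∏ t, ((⌊ψ j t α⌋ : ℤ) : ℝ)) * ψ₀ j α) :
      IsGPolZero d (h + 1) w φ

end GPol

end GenPoly

end

/-!
# Recurrence for generalized polynomial mappings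

The proof rests on the finite unions theorem (`exists_blockSystem_mono`): for every finite coloring
of the subsets of a large finite set there are disjoint nonempty blocks all of whose nonempty unions
have the same color. Passing from a mapping `f` on the subsets of `[1, r]` to `f` on the unions of
`s` blocks is restriction to a *block system*, and all the notions used here survive it.

If `P` is a polynomial mapping of degree `≤ d` with `P ∅ = 0`, color a set by the position of its
value modulo `1` up to a small error. On a monochromatic block system `P` is nearly equal to a
constant `θ` modulo `1` on all nonempty sets. A derivative of order `d + 1` at `∅` kills `P` and
turns this constant into `± θ`, so `θ` is nearly an integer
(`IsPolyMapZero.exists_int_near`). Hence `P` is nearly integer-valued on a block system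
(`exists_blockSystem_isNearInt`). The nearest-integer mapping `Z` is then itself polynomial, because
its derivatives of order `d + 1` are integers of absolute value less than `1`
(`IsPolyMapZero.of_near_int`). If the sign of `P - Z` is part of the color, the integer part of `P`
is `Z` or `Z - 1` uniformly on the nonempty sets.

So integer parts can be removed one after the other: on a block system every constant-free
generalized polynomial mapping is a nearly integer-valued polynomial mapping plus an integer
(`exists_blockSystem_isNearIntPolyAddInt`). The additive integer, to which closed summands
contribute, is invisible modulo `1`. The induction runs over the total degree, which makes `r`
depend on that degree only. A mapping of bounded degree, height and width has bounded total degree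
(`IsGPolZero.exists_isGenPoly`), and several mappings are treated by iterated restriction.
-/

namespace GenPoly

/-! ### Polynomial mappings -/

section PolynomialMappings

variable {A : Type*} [DecidableEq A] {H : Type*} [AddCommGroup H]

theorem setDeriv_add (β : Finset A) (φ ψ : Finset A → H) :
    setDeriv β (φ + ψ) = setDeriv β φ + setDeriv β ψ := by
  funext α; simp only [setDeriv, Pi.add_apply]; abel

theorem setDeriv_neg (β : Finset A) (φ : Finset A → H) : setDeriv β (-φ) = -setDeriv β φ := by
  funext α; simp only [setDeriv, Pi.neg_apply]; abel

theorem setDeriv_mul (β : Finset A) (φ ψ : Finset A → ℝ) :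
    setDeriv β (φ * ψ) =
      setDeriv β φ * ψ + φ * setDeriv β ψ + setDeriv β φ * setDeriv β ψ := by
  funext α; simp only [setDeriv, Pi.add_apply, Pi.mul_apply]; ring

theorem iterDeriv_add (L : List (Finset A)) (φ ψ : Finset A → H) :
    iterDeriv L (φ + ψ) = iterDeriv L φ + iterDeriv L ψ := by
  induction L generalizing φ ψ with
  | nil => rfl
  | cons β L ih => simp only [iterDeriv, setDeriv_add, ih]

theorem iterDeriv_neg (L : List (Finset A)) (φ : Finset A → H) :
    iterDeriv L (-φ) = -iterDeriv L φ := by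
  induction L generalizing φ with
  | nil => rfl
  | cons β L ih => simp only [iterDeriv, setDeriv_neg, ih]

theorem iterDeriv_zero (L : List (Finset A)) : iterDeriv L (0 : Finset A → H) = 0 := by
  simpa using iterDeriv_add L (0 : Finset A → H) 0

theorem iterDeriv_comp_addMonoidHom {K : Type*} [AddCommGroup K] (g : H →+ K)
    (L : List (Finset A)) (φ : Finset A → H) :
    iterDeriv L (fun α => g (φ α)) = fun α => g (iterDeriv L φ α) := by
  induction L generalizing φ with
  | nil => rfl
  | cons β L ih =>
    have : setDeriv β (fun α => g (φ α)) = fun α => g (setDeriv β φ α) := by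
      funext α; simp [setDeriv]
    simp only [iterDeriv, this, ih]

theorem abs_iterDeriv_le {δ : ℝ} (L : List (Finset A)) {φ : Finset A → ℝ}
    (h : ∀ α, |φ α| ≤ δ) (α : Finset A) : |iterDeriv L φ α| ≤ 2 ^ L.length * δ := by
  induction L generalizing φ δ with
  | nil => simpa [iterDeriv] using h α
  | cons β L ih =>
    have h' : ∀ α, |setDeriv β φ α| ≤ 2 * δ := fun α => by
      have := abs_sub (φ (α ∪ β)) (φ α)
      simp only [setDeriv]
      linarith [h α, h (α ∪ β)]
    calc |iterDeriv (β :: L) φ α| ≤ 2 ^ L.length * (2 * δ) := ih h'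
      _ = 2 ^ (β :: L).length * δ := by rw [List.length_cons, pow_succ]; ring

/-- The indicator of the nonempty sets behaves under derivatives like the negative of the indicator
of `∅`, each derivative of which along a nonempty set is its own negative. -/
theorem iterDeriv_indicator_nonempty (L : List (Finset A)) (hne : ∀ β ∈ L, β.Nonempty)
    (hL : L ≠ []) :
    iterDeriv L (fun α => if α = ∅ then (0 : ℝ) else 1) ∅ = (-1) ^ (L.length + 1) := by
  have key : ∀ (L : List (Finset A)), (∀ β ∈ L, β.Nonempty) → ∀ c : ℝ,
      iterDeriv L (fun α => if α = ∅ then c else 0) ∅ = c * (-1) ^ L.length := by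
    intro L
    induction L with
    | nil => intro _ c; simp [iterDeriv]
    | cons β L ih =>
      intro hne c
      have hβ : β ≠ ∅ := (hne β (by simp)).ne_empty
      have : setDeriv β (fun α : Finset A => if α = ∅ then c else 0) =
          fun α => if α = ∅ then -c else 0 := by
        funext α
        by_cases hα : α = ∅ <;> simp [setDeriv, hα, hβ, Finset.union_eq_empty]
      rw [iterDeriv, this, ih (fun β h => hne β (by simp [h])), List.length_cons, pow_succ]
      ring
  cases L with
  | nil => exact absurd rfl hL
  | cons β L =>
    have hβ : β ≠ ∅ := (hne β (by simp)).ne_empty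
    have : setDeriv β (fun α : Finset A => if α = ∅ then (0 : ℝ) else 1) =
        fun α => if α = ∅ then 1 else 0 := by
      funext α
      by_cases hα : α = ∅ <;> simp [setDeriv, hα, hβ, Finset.union_eq_empty]
    rw [iterDeriv, this, key L (fun β h => hne β (by simp [h])), List.length_cons]
    ring

/-- `φ`, considered on the finite sets disjoint from `F`, is polynomial of degree `< n` (and
vanishes there if `n = 0`). Keeping track of the forbidden set `F` allows inductions on the degree,
since `setDeriv β φ` is only controlled on the sets disjoint from `β`. -/
def IsPolyLT : ℕ → Finset A → (Finset A → H) → Prop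
  | 0, F, φ => ∀ α, Disjoint α F → φ α = 0
  | n + 1, F, φ => ∀ β, Disjoint β F → IsPolyLT n (F ∪ β) (setDeriv β φ)

theorem isPolyLT_iff (n : ℕ) (F : Finset A) (φ : Finset A → H) :
    IsPolyLT n F φ ↔ ∀ L : List (Finset A), L.length = n → L.Pairwise Disjoint →
      (∀ β ∈ L, Disjoint β F) → ∀ α, Disjoint α F → (∀ β ∈ L, Disjoint α β) →
        iterDeriv L φ α = 0 := by
  induction n generalizing F φ with
  | zero =>
    constructor
    · intro h L hL _ _ α hα _
      obtain rfl := List.length_eq_zero_iff.1 hL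
      exact h α hα
    · intro h α hα
      exact h [] rfl List.Pairwise.nil (by simp) α hα (by simp)
  | succ n ih =>
    constructor
    · intro h L hL hP hF α hα hd
      cases L with
      | nil => simp at hL
      | cons β L =>
        rw [List.pairwise_cons] at hP
        refine (ih _ _).1 (h β (hF β (by simp))) L (by simpa using hL) hP.2 ?_ α ?_ ?_
        · intro γ hγ
          exact Finset.disjoint_union_right.2 ⟨hF γ (by simp [hγ]), (hP.1 γ hγ).symm⟩
        · exact Finset.disjoint_union_right.2 ⟨hα, hd β (by simp)⟩
        · exact fun γ hγ => hd γ (by simp [hγ])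
    · intro h β hβ
      refine (ih _ _).2 fun L hL hP hF α hα hd => ?_
      simp only [Finset.disjoint_union_right] at hF hα
      refine h (β :: L) (by simp [hL]) (List.pairwise_cons.2 ⟨fun γ hγ => (hF γ hγ).2.symm, hP⟩)
        ?_ α hα.1 ?_
      · intro γ hγ
        rcases List.mem_cons.1 hγ with rfl | hγ
        exacts [hβ, (hF γ hγ).1]
      · intro γ hγ
        rcases List.mem_cons.1 hγ with rfl | hγ
        exacts [hα.2, hd γ hγ]

theorem isPolyMap_iff_isPolyLT {d : ℕ} {φ : Finset A → H} :
    IsPolyMap d φ ↔ IsPolyLT (d + 1) ∅ φ := by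
  simp [isPolyLT_iff, IsPolyMap]

theorem IsPolyLT.mono_set {n : ℕ} {F G : Finset A} {φ : Finset A → H} (h : IsPolyLT n F φ)
    (hFG : F ⊆ G) : IsPolyLT n G φ := by
  induction n generalizing F G φ with
  | zero => exact fun α hα => h α (hα.mono_right hFG)
  | succ n ih =>
    exact fun β hβ => ih (h β (hβ.mono_right hFG)) (Finset.union_subset_union_left hFG)

theorem IsPolyLT.succ {n : ℕ} {F : Finset A} {φ : Finset A → H} (h : IsPolyLT n F φ) :
    IsPolyLT (n + 1) F φ := by
  induction n generalizing F φ with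
  | zero =>
    intro β hβ α hα
    rw [Finset.disjoint_union_right] at hα
    simp [setDeriv, h α hα.1, h (α ∪ β) (Finset.disjoint_union_left.2 ⟨hα.1, hβ⟩)]
  | succ n ih => exact fun β hβ => ih (h β hβ)

theorem IsPolyLT.mono {m n : ℕ} {F : Finset A} {φ : Finset A → H} (h : IsPolyLT m F φ)
    (hmn : m ≤ n) : IsPolyLT n F φ :=
  Nat.le_induction h (fun _ _ => IsPolyLT.succ) n hmn

theorem IsPolyLT.add {n : ℕ} {F : Finset A} {φ ψ : Finset A → H} (hφ : IsPolyLT n F φ)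
    (hψ : IsPolyLT n F ψ) : IsPolyLT n F (φ + ψ) := by
  induction n generalizing F φ ψ with
  | zero => exact fun α hα => by simp [hφ α hα, hψ α hα]
  | succ n ih => exact fun β hβ => setDeriv_add β φ ψ ▸ ih (hφ β hβ) (hψ β hβ)

theorem IsPolyLT.mul {m n k : ℕ} {F : Finset A} {φ ψ : Finset A → ℝ} (hφ : IsPolyLT m F φ)
    (hψ : IsPolyLT n F ψ) (hk : m + n ≤ k + 1) : IsPolyLT k F (φ * ψ) := by
  induction k generalizing m n F φ ψ with
  | zero =>
    intro α hα
    obtain rfl | rfl : m = 0 ∨ n = 0 := by omega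
    · simp [hφ α hα]
    · simp [hψ α hα]
  | succ k ih =>
    cases m with
    | zero =>
      exact IsPolyLT.mono (m := 0) (fun α hα => by simp [hφ α hα]) (Nat.zero_le _)
    | succ m =>
      cases n with
      | zero =>
        exact IsPolyLT.mono (m := 0) (fun α hα => by simp [hψ α hα]) (Nat.zero_le _)
      | succ n =>
        intro β hβ
        have hF : F ⊆ F ∪ β := Finset.subset_union_left
        rw [setDeriv_mul]
        exact ((ih (hφ β hβ) (hψ.mono_set hF) (by omega)).add
          (ih (hφ.mono_set hF) (hψ β hβ) (by omega))).add (ih (hφ β hβ) (hψ β hβ) (by omega))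

namespace IsPolyMapZero

theorem mono {d e : ℕ} {φ : Finset A → H} (h : IsPolyMapZero d φ) (hde : d ≤ e) :
    IsPolyMapZero e φ :=
  ⟨isPolyMap_iff_isPolyLT.2 ((isPolyMap_iff_isPolyLT.1 h.1).mono (by omega)), h.2⟩

theorem zero (d : ℕ) : IsPolyMapZero d (0 : Finset A → H) :=
  ⟨fun L _ _ α _ => by simp [iterDeriv_zero], rfl⟩

theorem add {d : ℕ} {φ ψ : Finset A → H} (hφ : IsPolyMapZero d φ) (hψ : IsPolyMapZero d ψ) :
    IsPolyMapZero d (φ + ψ) :=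
  ⟨fun L hL hP α hα => by simp [iterDeriv_add, hφ.1 L hL hP α hα, hψ.1 L hL hP α hα],
    by simp [hφ.2, hψ.2]⟩

theorem neg {d : ℕ} {φ : Finset A → H} (hφ : IsPolyMapZero d φ) : IsPolyMapZero d (-φ) :=
  ⟨fun L hL hP α hα => by simp [iterDeriv_neg, hφ.1 L hL hP α hα], by simp [hφ.2]⟩

theorem mul {d e : ℕ} {φ ψ : Finset A → ℝ} (hφ : IsPolyMapZero d φ) (hψ : IsPolyMapZero e ψ) :
    IsPolyMapZero (d + e) (φ * ψ) :=
  ⟨isPolyMap_iff_isPolyLT.2 ((isPolyMap_iff_isPolyLT.1 hφ.1).mul (isPolyMap_iff_isPolyLT.1 hψ.1)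
    (by omega)), by simp [hφ.2]⟩

theorem const_mul {d : ℕ} {φ : Finset A → ℝ} (c : ℝ) (hφ : IsPolyMapZero d φ) :
    IsPolyMapZero d (fun α => c * φ α) :=
  ⟨fun L hL hP α hα => by
    have := congrFun (iterDeriv_comp_addMonoidHom (AddMonoidHom.mulLeft c) L φ) α
    simpa [hφ.1 L hL hP α hα] using this, by simp [hφ.2]⟩

theorem eq_zero {φ : Finset A → H} (h : IsPolyMapZero 0 φ) : φ = 0 := by
  funext α
  have := h.1 [α] rfl (List.pairwise_singleton _ _) ∅ (by simp)
  simpa [iterDeriv, setDeriv, h.2] using this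

/-- An integer-valued mapping close to a polynomial mapping is itself polynomial: its derivatives
of order `d + 1` are integers of absolute value less than `1`. -/
theorem of_near_int {d : ℕ} {ε : ℝ} (hε : 2 ^ (d + 1) * ε < 1) {P : Finset A → ℝ}
    (hP : IsPolyMapZero d P) {Z : Finset A → ℤ} (hZ : Z ∅ = 0)
    (hPZ : ∀ α, |P α - Z α| ≤ ε) : IsPolyMapZero d (fun α => (Z α : ℝ)) := by
  refine ⟨fun L hL hd α hα => ?_, by simp [hZ]⟩
  have h1 : iterDeriv L (fun α => (Z α : ℝ)) = fun α => ((iterDeriv L Z α : ℤ) : ℝ) :=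
    iterDeriv_comp_addMonoidHom (Int.castAddHom ℝ) L Z
  have h2 := abs_iterDeriv_le L (φ := P + -fun α => (Z α : ℝ))
    (fun α => by simpa [← sub_eq_add_neg] using hPZ α) α
  rw [iterDeriv_add, iterDeriv_neg, Pi.add_apply, hP.1 L hL hd α hα, zero_add, Pi.neg_apply,
    abs_neg, hL, h1] at h2
  rw [h1]
  have h3 : |iterDeriv L Z α| < 1 := by
    have := h2.trans_lt hε
    dsimp only at this
    exact_mod_cast this
  simp [Int.abs_lt_one_iff.1 h3]

/-- A polynomial mapping with zero constant term that, modulo `1`, is nearly equal to a constant `θ`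
on all nonempty sets forces `θ` to be nearly an integer: apply a derivative of order `d + 1` at `∅`,
which kills the polynomial and turns the constant on nonempty sets into `± θ`. -/
theorem exists_int_near {s d : ℕ} (hs : d + 1 ≤ s) {P : Finset (Fin s) → ℝ}
    (hP : IsPolyMapZero d P) {θ δ : ℝ} (hδ : 0 ≤ δ) (Z : Finset (Fin s) → ℤ)
    (h : ∀ α, α.Nonempty → |P α - Z α - θ| ≤ δ) : ∃ z : ℤ, |θ - z| ≤ 2 ^ (d + 1) * δ := by
  classical
  let L : List (Finset (Fin s)) := (List.finRange (d + 1)).map fun i => {Fin.castLE hs i}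
  have hL : L.length = d + 1 := by simp [L]
  have hLd : L.Pairwise Disjoint := by
    refine List.pairwise_map.2 ((List.nodup_finRange _).imp ?_)
    intro a b hab
    simpa using hab
  let W : Finset (Fin s) → ℤ := fun α => if α = ∅ then 0 else Z α
  let I : Finset (Fin s) → ℝ := fun α => if α = ∅ then 0 else 1
  have hI : iterDeriv L I ∅ = (-1) ^ (L.length + 1) :=
    iterDeriv_indicator_nonempty L (fun β hβ => by
      obtain ⟨i, -, rfl⟩ := List.mem_map.1 hβ
      simp) (by rintro h0; simp [h0] at hL)
  have h1 : iterDeriv L (fun α => (W α : ℝ)) = fun α => ((iterDeriv L W α : ℤ) : ℝ) :=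
    iterDeriv_comp_addMonoidHom (Int.castAddHom ℝ) L W
  have h2 : iterDeriv L (fun α => θ * I α) = fun α => θ * iterDeriv L I α :=
    iterDeriv_comp_addMonoidHom (AddMonoidHom.mulLeft θ) L I
  have h3 := abs_iterDeriv_le L (δ := δ)
    (φ := P + -(fun α => (W α : ℝ)) + -(fun α => θ * I α)) (fun α => by
      rcases α.eq_empty_or_nonempty with rfl | hα
      · simpa [W, I, hP.2] using hδ
      · simpa [W, I, hα.ne_empty, ← sub_eq_add_neg] using h α hα) ∅
  simp only [iterDeriv_add, iterDeriv_neg, Pi.add_apply, Pi.neg_apply, h1, h2, hI,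
    hP.1 L hL hLd ∅ (by simp), hL] at h3
  rcases neg_one_pow_eq_or ℝ (d + 1 + 1) with hs' | hs' <;> rw [hs'] at h3
  · refine ⟨-iterDeriv L W ∅, ?_⟩
    rw [abs_le] at h3 ⊢
    push_cast
    constructor <;> linarith [h3.1, h3.2]
  · refine ⟨iterDeriv L W ∅, ?_⟩
    rw [abs_le] at h3 ⊢
    constructor <;> linarith [h3.1, h3.2]

end IsPolyMapZero

end PolynomialMappings

/-! ### Block systems and the finite unions theorem -/

/-- A family of pairwise disjoint nonempty finite subsets of `A`, indexed by `ι`. Sending `β` to the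
union of the blocks with index in `β` embeds the finite subsets of `ι` into those of `A`. -/
structure BlockSystem (ι A : Type*) where
  /-- The block with a given index. -/
  block : ι → Finset A
  nonempty : ∀ i, (block i).Nonempty
  disjoint : ∀ i j, i ≠ j → Disjoint (block i) (block j)

namespace BlockSystem

variable {ι κ A : Type*} [DecidableEq A]

/-- The union of the blocks with index in `β`. -/
def union (S : BlockSystem ι A) (β : Finset ι) : Finset A := β.biUnion S.block

theorem union_union [DecidableEq ι] (S : BlockSystem ι A) (β γ : Finset ι) :
    S.union (β ∪ γ) = S.union β ∪ S.union γ := Finset.union_biUnion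

theorem union_nonempty (S : BlockSystem ι A) {β : Finset ι} (h : β.Nonempty) :
    (S.union β).Nonempty := by
  obtain ⟨i, hi⟩ := h
  obtain ⟨a, ha⟩ := S.nonempty i
  exact ⟨a, Finset.mem_biUnion.2 ⟨i, hi, ha⟩⟩

theorem union_disjoint (S : BlockSystem ι A) {β γ : Finset ι} (h : Disjoint β γ) :
    Disjoint (S.union β) (S.union γ) := by
  simp only [union, Finset.disjoint_biUnion_left, Finset.disjoint_biUnion_right]
  intro i hi j hj
  exact S.disjoint _ _ fun hij => Finset.disjoint_left.1 h hj (hij ▸ hi)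

/-- The block system whose blocks are unions of blocks of another one. -/
def comp [DecidableEq ι] (S : BlockSystem ι A) (T : BlockSystem κ ι) : BlockSystem κ A where
  block i := S.union (T.block i)
  nonempty i := S.union_nonempty (T.nonempty i)
  disjoint i j h := S.union_disjoint (T.disjoint i j h)

theorem comp_union [DecidableEq ι] (S : BlockSystem ι A) (T : BlockSystem κ ι) (β : Finset κ) :
    (S.comp T).union β = S.union (T.union β) := by
  simp only [union, comp, Finset.biUnion_biUnion]

/-- The system of singletons given by an injection. -/
def ofInjective (f : ι → A) (hf : Function.Injective f) : BlockSystem ι A where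
  block i := {f i}
  nonempty i := Finset.singleton_nonempty _
  disjoint i j h := by simpa using fun h' => h (hf h')

end BlockSystem

/-- A version of the finite unions theorem where the color of a union of blocks may still depend on
the least index of a block occurring in it. In the inductive step the new first block is the fixed
part of a combinatorial line over the alphabet of all subsets of `Fin m`, and the remaining blocks
are unions of its `m` moving parts. -/
theorem exists_blockSystem_color_eq_of_min (κ : Type) [Finite κ] (n : ℕ) :
    ∃ r : ℕ, ∀ c : Finset (Fin r) → κ, ∃ (S : BlockSystem (Fin n) (Fin r)) (col : Fin n → κ),
      ∀ i β, (∀ j ∈ β, i < j) → c (S.union (insert i β)) = col i := by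
  induction n with
  | zero =>
    exact ⟨0, fun c => ⟨⟨Fin.elim0, fun i => i.elim0, fun i => i.elim0⟩, Fin.elim0,
      fun i => i.elim0⟩⟩
  | succ n ih =>
    classical
    obtain ⟨m, hm⟩ := ih
    obtain ⟨ι, _, hι⟩ := Combinatorics.Line.exists_mono_in_high_dimension (Finset (Fin m)) κ
    let e := Fintype.equivFin (Option (ι × Fin m))
    refine ⟨Fintype.card (Option (ι × Fin m)), fun c' => ?_⟩
    let E : BlockSystem (Option (ι × Fin m)) (Fin _) := .ofInjective e e.injective
    let c : Finset (Option (ι × Fin m)) → κ := fun α => c' (E.union α)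
    suffices ∃ (S : BlockSystem (Fin (n + 1)) (Option (ι × Fin m))) (col : Fin (n + 1) → κ),
        ∀ i β, (∀ j ∈ β, i < j) → c (S.union (insert i β)) = col i by
      obtain ⟨S, col, h⟩ := this
      exact ⟨E.comp S, col, fun i β hβ => by rw [E.comp_union]; exact h i β hβ⟩
    -- The element `none` makes the fixed part of every line nonempty.
    let U : (ι → Finset (Fin m)) → Finset (Option (ι × Fin m)) := fun w =>
      Finset.univ.filter fun o => ∀ p, o = some p → p.2 ∈ w p.1
    obtain ⟨l, k, hl⟩ := hι fun w => c (U w)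
    let b : BlockSystem (Fin m) (Option (ι × Fin m)) :=
      { block := fun j =>
          Finset.univ.filter fun o => ∃ i, l.idxFun i = none ∧ o = some (i, j)
        nonempty := fun j => by
          obtain ⟨i, hi⟩ := l.proper
          exact ⟨some (i, j), by simp [hi]⟩
        disjoint := fun i j hij => by
          rw [Finset.disjoint_left]
          rintro o ho ho'
          simp only [Finset.mem_filter, Finset.mem_univ, true_and] at ho ho'
          obtain ⟨a, -, rfl⟩ := ho
          obtain ⟨a', -, h⟩ := ho'
          exact hij (by simpa using congrArg Prod.snd (Option.some.inj h)) }
    let a : Finset (Option (ι × Fin m)) :=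
      Finset.univ.filter fun o => ∀ p, o = some p → ∃ y, l.idxFun p.1 = some y ∧ p.2 ∈ y
    have hU : ∀ x, U (l x) = a ∪ b.union x := by
      intro x
      ext o
      simp only [U, a, b, BlockSystem.union, Finset.mem_filter, Finset.mem_univ, true_and,
        Finset.mem_union, Finset.mem_biUnion]
      cases o with
      | none => simp
      | some p =>
        obtain ⟨i, j⟩ := p
        cases hi : l.idxFun i with
        | none => simp [hi]
        | some y => simp [hi]
    have hab : ∀ x, Disjoint a (b.union x) := by
      intro x
      rw [Finset.disjoint_left]
      intro o ho ho'
      simp only [a, b, BlockSystem.union, Finset.mem_filter, Finset.mem_univ, true_and,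
        Finset.mem_biUnion] at ho ho'
      obtain ⟨j, -, i, hi, rfl⟩ := ho'
      obtain ⟨y, hy, -⟩ := ho _ rfl
      simp [hi] at hy
    obtain ⟨S, col, hS⟩ := hm fun x => c (b.union x)
    let T : BlockSystem (Fin (n + 1)) (Option (ι × Fin m)) :=
      { block := Fin.cons a (b.comp S).block
        nonempty := by
          refine Fin.cases ⟨none, by simp [a]⟩ fun i => ?_
          exact (b.comp S).nonempty i
        disjoint := by
          refine Fin.cases (Fin.cases (fun h => absurd rfl h) fun j _ => hab _)
            fun i => Fin.cases (fun _ => (hab _).symm) fun j h => ?_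
          exact (b.comp S).disjoint i j fun hij => h (congrArg _ hij) }
    have hT : ∀ β : Finset (Fin n), T.union (β.image Fin.succ) = b.union (S.union β) := by
      intro β
      rw [← b.comp_union]
      simp only [BlockSystem.union, Finset.image_biUnion]
      rfl
    have hβ' : ∀ β : Finset (Fin (n + 1)), (∀ j ∈ β, 0 < j) → ∃ γ : Finset (Fin n),
        β = γ.image Fin.succ := by
      intro β h
      refine ⟨Finset.univ.filter fun j => j.succ ∈ β, ?_⟩
      ext j
      refine Fin.cases ?_ (fun j => ?_) j
      · simpa using fun h0 => lt_irrefl _ (h 0 h0)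
      · simp
    refine ⟨T, Fin.cons k col, Fin.cases ?_ ?_⟩
    · intro β hβ
      obtain ⟨γ, rfl⟩ := hβ' β hβ
      rw [Finset.insert_eq, T.union_union, hT]
      have : T.union {0} = a := by simp [BlockSystem.union, T]
      rw [this, ← hU]
      exact hl _
    · intro i β hβ
      obtain ⟨γ, rfl⟩ := hβ' β fun j hj => (Fin.succ_pos i).trans (hβ j hj)
      rw [← Finset.image_insert, hT]
      refine hS i γ fun j hj => ?_
      simpa using hβ j.succ (Finset.mem_image_of_mem _ hj)

/-- The finite unions theorem of Folkman, Rado and Sanders: for every finite coloring of the subsets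
of a large finite set there are `s` disjoint nonempty blocks all of whose nonempty unions have the
same color. -/
theorem exists_blockSystem_mono (κ : Type) [Finite κ] (s : ℕ) :
    ∃ r : ℕ, ∀ c : Finset (Fin r) → κ, ∃ (S : BlockSystem (Fin s) (Fin r)) (k : κ),
      ∀ β : Finset (Fin s), β.Nonempty → c (S.union β) = k := by
  classical
  have := Fintype.ofFinite κ
  obtain ⟨r, hr⟩ := exists_blockSystem_color_eq_of_min κ (Fintype.card κ * s)
  refine ⟨r, fun c => ?_⟩
  obtain ⟨S, col, hS⟩ := hr c
  rcases Nat.eq_zero_or_pos s with rfl | hs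
  · refine ⟨⟨Fin.elim0, fun i => i.elim0, fun i => i.elim0⟩, c ∅, fun β hβ => ?_⟩
    exact hβ.choose.elim0
  · have : Nonempty κ := ⟨c ∅⟩
    obtain ⟨k, hk⟩ := Fintype.exists_le_card_fiber_of_mul_le_card (n := s) col (by simp)
    let j := Finset.orderEmbOfCardLe _ hk
    have hj : ∀ i, col (j i) = k := fun i => by
      have := Finset.orderEmbOfCardLe_mem _ hk i
      simpa using this
    let J : BlockSystem (Fin s) (Fin (Fintype.card κ * s)) := .ofInjective j j.injective
    refine ⟨S.comp J, k, fun β hβ => ?_⟩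
    have hJ : J.union β = β.image j := by
      ext; simp [J, BlockSystem.union, BlockSystem.ofInjective, eq_comm]
    rw [BlockSystem.comp_union, hJ]
    -- Split off the least index.
    have hne : (β.image j).Nonempty := hβ.image _
    obtain ⟨i, -, hi⟩ := Finset.mem_image.1 (Finset.min'_mem _ hne)
    rw [← Finset.insert_erase (Finset.min'_mem _ hne), hS, ← hi, hj]
    intro t ht
    exact Finset.min'_lt_of_mem_erase_min' _ hne ht

/-! ### Polynomial mappings that are nearly integer-valued -/

section Near

variable {A B : Type*} [DecidableEq A]

theorem iterDeriv_comp_union [DecidableEq B] {H : Type*} [AddCommGroup H] (S : BlockSystem B A)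
    (L : List (Finset B)) (φ : Finset A → H) (α : Finset B) :
    iterDeriv L (φ ∘ S.union) α = iterDeriv (L.map S.union) φ (S.union α) := by
  induction L generalizing φ with
  | nil => rfl
  | cons β L ih =>
    have : setDeriv β (φ ∘ S.union) = setDeriv (S.union β) φ ∘ S.union := by
      funext α; simp [setDeriv, S.union_union]
    rw [iterDeriv, this, ih]
    rfl

theorem IsPolyMapZero.comp_union [DecidableEq B] {H : Type*} [AddCommGroup H] {d : ℕ} {φ : Finset A → H}
    (h : IsPolyMapZero d φ) (S : BlockSystem B A) : IsPolyMapZero d (φ ∘ S.union) := by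
  refine ⟨fun L hL hP α hα => ?_, h.2⟩
  rw [iterDeriv_comp_union]
  refine h.1 _ (by simpa using hL) (List.pairwise_map.2 (hP.imp S.union_disjoint)) _ ?_
  intro β hβ
  obtain ⟨γ, hγ, rfl⟩ := List.mem_map.1 hβ
  exact S.union_disjoint (hα γ hγ)

/-- `P` is within `ε` of an integer-valued mapping, and the sign of the difference is the same on
all nonempty sets. The latter makes the integer part of `P` differ from that integer-valued mapping
by a constant on the nonempty sets. -/
def IsNearInt (ε : ℝ) (P : Finset A → ℝ) : Prop :=
  ∃ (Z : Finset A → ℤ) (σ : SignType), Z ∅ = 0 ∧ (∀ α, |P α - Z α| ≤ ε) ∧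
    ∀ α, α.Nonempty → SignType.sign (P α - Z α) = σ

theorem IsNearInt.comp_union {ε : ℝ} {P : Finset A → ℝ} (h : IsNearInt ε P)
    (S : BlockSystem B A) : IsNearInt ε (P ∘ S.union) := by
  obtain ⟨Z, σ, h0, hZ, hσ⟩ := h
  exact ⟨Z ∘ S.union, σ, h0, fun α => hZ _, fun α hα => hσ _ (S.union_nonempty hα)⟩

/-- Every polynomial mapping with zero constant term becomes nearly integer-valued on a suitable
block system. -/
theorem exists_blockSystem_isNearInt (N s : ℕ) {ε : ℝ} (hε : 0 < ε) :
    ∃ r : ℕ, ∀ P : Finset (Fin r) → ℝ, IsPolyMapZero N P →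
      ∃ S : BlockSystem (Fin s) (Fin r), IsNearInt ε (P ∘ S.union) := by
  obtain ⟨q, hq⟩ := exists_nat_gt ((2 ^ (N + 1) + 1) / ε)
  have hq0 : (0 : ℝ) < q := lt_trans (by positivity) hq
  have hqε : (2 ^ (N + 1) + 1) * (1 / (q : ℝ)) ≤ ε := by
    rw [div_lt_iff₀ hε] at hq
    rw [mul_one_div, div_le_iff₀ hq0]
    linarith
  -- At least `N + 1` blocks are needed to take a derivative of order `N + 1`.
  obtain ⟨r, hr⟩ := exists_blockSystem_mono (Fin q × SignType) (max s (N + 1))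
  refine ⟨r, fun P hP => ?_⟩
  have hcell : ∀ x : ℝ, ⌊Int.fract x * q⌋₊ < q := fun x => by
    rw [Nat.floor_lt (mul_nonneg (Int.fract_nonneg x) hq0.le)]
    exact mul_lt_of_lt_one_left hq0 (Int.fract_lt_one x)
  obtain ⟨S, ⟨k, σ⟩, hS⟩ := hr fun α =>
    (⟨_, hcell (P α)⟩, SignType.sign (P α - round (P α)))
  set Q := P ∘ S.union with hQdef
  have hQ : IsPolyMapZero N Q := hP.comp_union S
  have hθ : ∀ α, α.Nonempty → |Q α - ⌊Q α⌋ - (k : ℕ) / (q : ℝ)| ≤ 1 / q := by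
    intro α hα
    have h1 : ⌊Int.fract (Q α) * q⌋₊ = (k : ℕ) :=
      congrArg (fun p : Fin q × SignType => (p.1 : ℕ)) (hS α hα)
    have h2 := (Nat.floor_eq_iff (mul_nonneg (Int.fract_nonneg (Q α)) hq0.le)).1 h1
    change |Int.fract (Q α) - (k : ℕ) / (q : ℝ)| ≤ 1 / q
    have h3 : Int.fract (Q α) = Int.fract (Q α) * q / q := by field_simp
    rw [h3, ← sub_div, abs_div, abs_of_pos hq0]
    gcongr
    rw [abs_le]
    constructor <;> linarith [h2.1, h2.2]
  obtain ⟨z, hz⟩ := hQ.exists_int_near (le_max_right _ _) (by positivity) (fun α => ⌊Q α⌋) hθ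
  have hround : ∀ α, |Q α - round (Q α)| ≤ ε := by
    intro α
    rcases α.eq_empty_or_nonempty with rfl | hα
    · simp [hQ.2, hε.le]
    · refine (round_le (Q α) (⌊Q α⌋ + z)).trans (le_trans ?_ hqε)
      have := abs_add_le (Q α - ⌊Q α⌋ - (k : ℕ) / (q : ℝ)) ((k : ℕ) / (q : ℝ) - z)
      have h4 : Q α - ⌊Q α⌋ - (k : ℕ) / (q : ℝ) + ((k : ℕ) / (q : ℝ) - z) =
          Q α - ((⌊Q α⌋ + z : ℤ) : ℝ) := by push_cast; ring
      rw [h4] at this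
      linarith [hθ α hα]
  have hQnear : IsNearInt ε Q :=
    ⟨fun α => round (Q α), σ, by simp [hQ.2], hround, fun α hα => congrArg Prod.snd (hS α hα)⟩
  let T : BlockSystem (Fin s) (Fin (max s (N + 1))) :=
    .ofInjective (Fin.castLE (le_max_left _ _)) (Fin.castLE_injective _)
  refine ⟨S.comp T, ?_⟩
  have := hQnear.comp_union T
  rwa [hQdef, Function.comp_assoc, show S.union ∘ T.union = (S.comp T).union from
    funext fun β => (S.comp_union T β).symm] at this

/-- On the nonempty sets, `f` is the sum of a polynomial mapping of degree `≤ d` with zero constant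
term and an integer. -/
def IsPolyAddInt (d : ℕ) (f : Finset A → ℝ) : Prop :=
  ∃ (P : Finset A → ℝ) (c : ℤ), IsPolyMapZero d P ∧ ∀ α, α.Nonempty → f α = P α + c

theorem IsPolyAddInt.add {d e : ℕ} {f g : Finset A → ℝ} (hf : IsPolyAddInt d f)
    (hg : IsPolyAddInt e g) : IsPolyAddInt (d + e) (f + g) := by
  obtain ⟨P, c, hP, hf⟩ := hf
  obtain ⟨Q, c', hQ, hg⟩ := hg
  refine ⟨P + Q, c + c', (hP.mono (by omega)).add (hQ.mono (by omega)), fun α hα => ?_⟩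
  simp only [Pi.add_apply, hf α hα, hg α hα]
  push_cast
  ring

theorem IsPolyAddInt.mul {d e : ℕ} {f g : Finset A → ℝ} (hf : IsPolyAddInt d f)
    (hg : IsPolyAddInt e g) : IsPolyAddInt (d + e) (f * g) := by
  obtain ⟨P, c, hP, hf⟩ := hf
  obtain ⟨Q, c', hQ, hg⟩ := hg
  refine ⟨P * Q + (fun α => (c' : ℝ) * P α) + (fun α => (c : ℝ) * Q α), c * c',
    ((hP.mul hQ).add ((hP.const_mul _).mono (by omega))).add ((hQ.const_mul _).mono (by omega)),
    fun α hα => ?_⟩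
  simp only [Pi.add_apply, Pi.mul_apply, hf α hα, hg α hα]
  push_cast
  ring

theorem IsPolyAddInt.comp_union [DecidableEq B] {d : ℕ} {f : Finset A → ℝ} (hf : IsPolyAddInt d f)
    (S : BlockSystem B A) : IsPolyAddInt d (f ∘ S.union) := by
  obtain ⟨P, c, hP, hf⟩ := hf
  exact ⟨P ∘ S.union, c, hP.comp_union S, fun α hα => hf _ (S.union_nonempty hα)⟩

/-- A refinement of `IsPolyAddInt` where the polynomial summand is nearly integer-valued. For small
`ε` it is preserved by taking the integer part. -/
def IsNearIntPolyAddInt (d : ℕ) (ε : ℝ) (f : Finset A → ℝ) : Prop :=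
  ∃ (P : Finset A → ℝ) (c : ℤ), IsPolyMapZero d P ∧ IsNearInt ε P ∧
    ∀ α, α.Nonempty → f α = P α + c

namespace IsNearIntPolyAddInt

theorem isPolyAddInt {d : ℕ} {ε : ℝ} {f : Finset A → ℝ} (h : IsNearIntPolyAddInt d ε f) :
    IsPolyAddInt d f := by
  obtain ⟨P, c, hP, -, hf⟩ := h
  exact ⟨P, c, hP, hf⟩

theorem neg {d : ℕ} {ε : ℝ} {f : Finset A → ℝ} (h : IsNearIntPolyAddInt d ε f) :
    IsNearIntPolyAddInt d ε (-f) := by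
  obtain ⟨P, c, hP, ⟨Z, σ, h0, hZ, hσ⟩, hf⟩ := h
  refine ⟨-P, -c, hP.neg, ⟨-Z, -σ, by simp [h0], fun α => ?_, fun α hα => ?_⟩, fun α hα => ?_⟩
  · have := hZ α
    rw [abs_sub_comm] at this
    simpa [neg_add_eq_sub] using this
  · rw [← hσ α hα, ← Left.sign_neg]
    congr 1
    simp only [Pi.neg_apply, Int.cast_neg]
    ring
  · simp only [Pi.neg_apply, hf α hα, Int.cast_neg]
    ring

theorem floor {d : ℕ} {ε : ℝ} (hε : 2 ^ (d + 1) * ε < 1) {f : Finset A → ℝ}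
    (h : IsNearIntPolyAddInt d ε f) :
    IsNearIntPolyAddInt d ε (fun α => ((⌊f α⌋ : ℤ) : ℝ)) := by
  obtain ⟨P, c, hP, ⟨Z, σ, h0, hZ, hσ⟩, hf⟩ := h
  have hε0 : 0 ≤ ε := (abs_nonneg _).trans (hZ ∅)
  have hε1 : ε < 1 := by
    have : (1 : ℝ) ≤ 2 ^ (d + 1) := one_le_pow₀ (by norm_num)
    nlinarith
  refine ⟨fun α => Z α, c + if σ = -1 then -1 else 0, hP.of_near_int hε h0 hZ,
    ⟨Z, 0, h0, fun α => by simpa using hε0, fun α _ => by simp⟩, fun α hα => ?_⟩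
  have hz := abs_le.1 (hZ α)
  have hs := hσ α hα
  beta_reduce
  rw [hf α hα, ← Int.cast_add, Int.cast_inj, Int.floor_eq_iff]
  split_ifs with hσ'
  · rw [hσ', sign_eq_neg_one_iff] at hs
    push_cast
    constructor <;> linarith
  · have : 0 ≤ P α - Z α := by
      by_contra hneg
      exact hσ' (by rw [← hs, sign_eq_neg_one_iff]; linarith)
    push_cast
    constructor <;> linarith

theorem zero {d : ℕ} {ε : ℝ} (hε : 0 ≤ ε) : IsNearIntPolyAddInt d ε (0 : Finset A → ℝ) :=
  ⟨0, 0, .zero d, ⟨0, 0, rfl, fun α => by simpa using hε, fun α _ => by simp⟩,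
    fun α _ => by simp⟩

theorem distInt_le {d : ℕ} {ε : ℝ} {f : Finset A → ℝ} (h : IsNearIntPolyAddInt d ε f)
    {α : Finset A} (hα : α.Nonempty) : distInt (f α) ≤ ε := by
  obtain ⟨P, c, -, ⟨Z, -, -, hZ, -⟩, hf⟩ := h
  refine (Metric.infDist_le_dist_of_mem (Set.mem_range_self (Z α + c))).trans ?_
  rw [hf α hα, Real.dist_eq]
  simpa using hZ α

end IsNearIntPolyAddInt

end Near

/-! ### Generalized polynomial mappings -/

section Generalized

variable {A B : Type*} [DecidableEq A] [DecidableEq B]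

/-- `f` is a constant-free generalized polynomial mapping of total degree `≤ d`, where closed
summands are allowed. The index `d` is a sum of upper bounds for the degrees of the polynomial
mappings used; unlike the sum of the exact degrees, it is unaffected by passing to a block
system. -/
inductive IsGenPoly : ℕ → (Finset A → ℝ) → Prop
  | poly {d : ℕ} {p : Finset A → ℝ} (hp : IsPolyMapZero d p) : IsGenPoly d p
  | add {d e : ℕ} {f g : Finset A → ℝ} (hf : IsGenPoly d f) (hg : IsGenPoly e g) :
      IsGenPoly (d + e) (f + g)
  | neg {d : ℕ} {f : Finset A → ℝ} (hf : IsGenPoly d f) : IsGenPoly d (-f)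
  | mul {d e : ℕ} {f g : Finset A → ℝ} (hf : IsGenPoly d f) (hg : IsGenPoly e g) :
      IsGenPoly (d + e) (f * g)
  | floor {d : ℕ} {f : Finset A → ℝ} (hf : IsGenPoly d f) :
      IsGenPoly d (fun α => ((⌊f α⌋ : ℤ) : ℝ))

theorem Rep.isGenPoly (e : Rep A) (he : e.ConstantFree) : IsGenPoly e.totalDegree e.eval := by
  induction e with
  | poly p hp => exact .poly ⟨Nat.sInf_mem hp, he⟩
  | add e f ihe ihf => exact .add (ihe he.1) (ihf he.2)
  | neg e ih => exact .neg (ih he)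
  | mul e f ihe ihf => exact .mul (ihe he.1) (ihf he.2)
  | floor e ih => exact .floor (ih he)

theorem IsGenPoly.comp_union {d : ℕ} {f : Finset A → ℝ} (h : IsGenPoly d f)
    (S : BlockSystem B A) : IsGenPoly d (f ∘ S.union) := by
  induction h with
  | poly hp => exact .poly (hp.comp_union S)
  | add _ _ ihf ihg => exact .add ihf ihg
  | neg _ ih => exact .neg ih
  | mul _ _ ihf ihg => exact .mul ihf ihg
  | floor _ ih => exact .floor ih

theorem IsGenPoly.eq_zero {d : ℕ} {f : Finset A → ℝ} (h : IsGenPoly d f) (hd : d = 0) :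
    f = 0 := by
  induction h with
  | poly hp => exact (hd ▸ hp).eq_zero
  | add _ _ ihf ihg => rw [ihf (by omega), ihg (by omega), add_zero]
  | neg _ ih => rw [ih hd, neg_zero]
  | mul _ _ ihf ihg => rw [ihf (by omega), zero_mul]
  | floor _ ih => funext α; simp [ih hd]

theorem IsGenPoly.sum {ι : Type*} (s : Finset ι) (D : ι → ℕ) (f : ι → Finset A → ℝ)
    (h : ∀ i ∈ s, IsGenPoly (D i) (f i)) : IsGenPoly (∑ i ∈ s, D i) (∑ i ∈ s, f i) := by
  classical
  induction s using Finset.induction_on with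
  | empty => simpa using IsGenPoly.poly (.zero 0)
  | insert i s hi ih =>
    rw [Finset.sum_insert hi, Finset.sum_insert hi]
    exact .add (h i (by simp)) (ih fun j hj => h j (by simp [hj]))

theorem IsGenPoly.prod_floor_mul {ι : Type*} (s : Finset ι) (D : ι → ℕ) (f : ι → Finset A → ℝ)
    (h : ∀ i ∈ s, IsGenPoly (D i) (f i)) {d : ℕ} {g : Finset A → ℝ} (hg : IsGenPoly d g) :
    IsGenPoly (d + ∑ i ∈ s, D i) (fun α => (∏ i ∈ s, ((⌊f i α⌋ : ℤ) : ℝ)) * g α) := by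
  classical
  induction s using Finset.induction_on with
  | empty => simpa using hg
  | insert i s hi ih =>
    have := IsGenPoly.mul (h i (by simp)).floor (ih fun j hj => h j (by simp [hj]))
    rw [Finset.sum_insert hi]
    convert this using 1
    · omega
    · funext α
      simp only [Finset.prod_insert hi, Pi.mul_apply, mul_assoc]

/-- A bound for the total degree of a generalized polynomial mapping in terms of its degree `d`,
height `h` and width `w`. -/
def totalDegreeBound (d w : ℕ) : ℕ → ℕ
  | 0 => d
  | h + 1 => d + w * (d + totalDegreeBound d w h)

theorem totalDegreeBound_mono {d d' : ℕ} (hd : d ≤ d') (w h : ℕ) :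
    totalDegreeBound d w h ≤ totalDegreeBound d' w h := by
  induction h with
  | zero => exact hd
  | succ h ih => unfold totalDegreeBound; gcongr

theorem le_totalDegreeBound (d w h : ℕ) : d ≤ totalDegreeBound d w h := by
  cases h with
  | zero => exact le_rfl
  | succ h => exact Nat.le_add_right _ _

theorem IsGPolZero.exists_isGenPoly {d h w : ℕ} {φ : Finset A → ℝ} (hφ : IsGPolZero d h w φ) :
    ∃ D ≤ totalDegreeBound d w h, IsGenPoly D φ := by
  induction hφ with
  | poly hw hφ => exact ⟨_, le_totalDegreeBound _ _ _, .poly hφ⟩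
  | @sum d h w φ m l ψ₀ ψ e₀ e hψ₀ hψ hdeg hwidth hφ ih =>
    choose D hD hDψ using ih
    refine ⟨∑ j, (e₀ j + ∑ t, D j t), ?_, ?_⟩
    · have hj : ∀ j, e₀ j + ∑ t, D j t ≤ (l j + 1) * (d + totalDegreeBound d w h) := by
        intro j
        have h0 : e₀ j ≤ d := (Nat.le_add_right _ _).trans (hdeg j)
        have ht : ∀ t, D j t ≤ totalDegreeBound d w h := fun t =>
          (hD j t).trans (totalDegreeBound_mono
            (((Finset.single_le_sum (fun _ _ => Nat.zero_le _) (Finset.mem_univ t)).trans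
              (Nat.le_add_left _ _)).trans (hdeg j)) w h)
        have hs : ∑ t, D j t ≤ l j * totalDegreeBound d w h := by
          simpa using Finset.sum_le_card_nsmul Finset.univ _ _ fun t _ => ht t
        nlinarith [Nat.zero_le (l j * d), Nat.zero_le (totalDegreeBound d w h)]
      calc ∑ j, (e₀ j + ∑ t, D j t) ≤ ∑ j, (l j + 1) * (d + totalDegreeBound d w h) :=
            Finset.sum_le_sum fun j _ => hj j
        _ = (∑ j, (l j + 1)) * (d + totalDegreeBound d w h) := (Finset.sum_mul ..).symm
        _ ≤ w * (d + totalDegreeBound d w h) := Nat.mul_le_mul_right _ hwidth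
        _ ≤ totalDegreeBound d w (h + 1) := Nat.le_add_left _ _
    · have := IsGenPoly.sum Finset.univ _ _ fun j _ =>
        IsGenPoly.prod_floor_mul Finset.univ (D j) (ψ j) (fun t _ => hDψ j t) (.poly (hψ₀ j))
      convert this using 1
      funext α
      rw [hφ α, Finset.sum_apply]

end Generalized

/-! ### Recurrence for generalized polynomial mappings -/

/-- On a suitable block system, a constant-free generalized polynomial mapping is the sum of a
nearly integer-valued polynomial mapping and an integer.

The number of operations in an expression is not bounded in terms of its total degree. But a block
system has to be chosen only at polynomial leaves and at sums and products of two expressions of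
positive total degree: an expression of total degree `0` vanishes, and negation and integer part
preserve the conclusion on the same block system. -/
theorem exists_blockSystem_isNearIntPolyAddInt {N : ℕ} {ε : ℝ} (hε : 0 < ε)
    (hN : 2 ^ (N + 1) * ε < 1) (D : ℕ) (hD : D ≤ N) (s : ℕ) :
    ∃ r : ℕ, ∀ (d : ℕ) (f : Finset (Fin r) → ℝ), d ≤ D → IsGenPoly d f →
      ∃ S : BlockSystem (Fin s) (Fin r), IsNearIntPolyAddInt d ε (f ∘ S.union) := by
  induction D generalizing s with
  | zero =>
    refine ⟨s, fun d f hd hf => ⟨.ofInjective id Function.injective_id, ?_⟩⟩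
    rw [hf.eq_zero (by omega)]
    exact .zero hε.le
  | succ D ih =>
    obtain ⟨r₀, hr₀⟩ := exists_blockSystem_isNearInt N s hε
    obtain ⟨r₁, hr₁⟩ := ih (by omega) r₀
    obtain ⟨r₂, hr₂⟩ := ih (by omega) r₁
    -- A polynomial mapping plus an integer, given on `r₀` blocks, can be made nearly integer.
    have refine_near : ∀ (d : ℕ) (f : Finset (Fin r₂) → ℝ) (T : BlockSystem (Fin r₀) (Fin r₂)),
        d ≤ N → IsPolyAddInt d (f ∘ T.union) →
        ∃ S : BlockSystem (Fin s) (Fin r₂), IsNearIntPolyAddInt d ε (f ∘ S.union) := by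
      rintro d f T hd ⟨P, c, hP, hf⟩
      obtain ⟨S, hS⟩ := hr₀ P (hP.mono hd)
      refine ⟨T.comp S, P ∘ S.union, c, hP.comp_union S, hS, fun α hα => ?_⟩
      rw [Function.comp_apply, T.comp_union]
      exact hf _ (S.union_nonempty hα)
    -- Two mappings of smaller total degree become polynomial up to integers simultaneously.
    have pair : ∀ (d e : ℕ) (f g : Finset (Fin r₂) → ℝ), d ≤ D → e ≤ D → IsGenPoly d f →
        IsGenPoly e g → ∃ T : BlockSystem (Fin r₀) (Fin r₂),
          IsPolyAddInt d (f ∘ T.union) ∧ IsPolyAddInt e (g ∘ T.union) := by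
      intro d e f g hd he hf hg
      obtain ⟨T₁, h₁⟩ := hr₂ d f hd hf
      obtain ⟨T₂, h₂⟩ := hr₁ e _ he (hg.comp_union T₁)
      have hT : (T₁.comp T₂).union = T₁.union ∘ T₂.union := funext (T₁.comp_union T₂)
      exact ⟨T₁.comp T₂, hT ▸ h₁.isPolyAddInt.comp_union T₂, hT ▸ h₂.isPolyAddInt⟩
    refine ⟨r₂, fun d f hd hf => ?_⟩
    induction hf with
    | @poly d p hp =>
      obtain ⟨T, -, -⟩ := pair 0 0 0 0 (Nat.zero_le _) (Nat.zero_le _) (.poly (.zero 0))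
        (.poly (.zero 0))
      exact refine_near d p T (by omega) ⟨_, 0, hp.comp_union T, fun α _ => by simp⟩
    | @add d e f g hf hg ihf ihg =>
      rcases Nat.eq_zero_or_pos d with rfl | hd0
      · rw [hf.eq_zero rfl, zero_add, zero_add]
        exact ihg (by omega)
      rcases Nat.eq_zero_or_pos e with rfl | he0
      · rw [hg.eq_zero rfl, add_zero, add_zero]
        exact ihf (by omega)
      obtain ⟨T, h₁, h₂⟩ := pair d e f g (by omega) (by omega) hf hg
      exact refine_near _ _ T (by omega) (h₁.add h₂)
    | neg _ ih =>
      obtain ⟨S, hS⟩ := ih hd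
      exact ⟨S, hS.neg⟩
    | @mul d e f g hf hg ihf ihg =>
      obtain ⟨T₀, -, -⟩ := pair 0 0 0 0 (Nat.zero_le _) (Nat.zero_le _) (.poly (.zero 0))
        (.poly (.zero 0))
      have hzero : IsPolyAddInt (d + e) ((0 : Finset (Fin r₂) → ℝ) ∘ T₀.union) :=
        ⟨0, 0, .zero _, fun α _ => by simp⟩
      rcases Nat.eq_zero_or_pos d with rfl | hd0
      · rw [hf.eq_zero rfl, zero_mul]
        exact refine_near _ _ T₀ (by omega) hzero
      rcases Nat.eq_zero_or_pos e with rfl | he0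
      · rw [hg.eq_zero rfl, mul_zero]
        exact refine_near _ _ T₀ (by omega) hzero
      obtain ⟨T, h₁, h₂⟩ := pair d e f g (by omega) (by omega) hf hg
      exact refine_near _ _ T (by omega) (h₁.mul h₂)
    | @floor d f _ ih =>
      obtain ⟨S, hS⟩ := ih hd
      refine ⟨S, hS.floor (lt_of_le_of_lt ?_ hN)⟩
      have : d + 1 ≤ N + 1 := by omega
      gcongr
      norm_num

/-- Finitely many constant-free generalized polynomial mappings become simultaneously close to
integers on a suitable block system. -/
theorem exists_blockSystem_distInt_lt (D k s : ℕ) {ε : ℝ} (hε : 0 < ε) :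
    ∃ r : ℕ, ∀ f : Fin k → Finset (Fin r) → ℝ, (∀ i, ∃ d ≤ D, IsGenPoly d (f i)) →
      ∃ S : BlockSystem (Fin s) (Fin r), ∀ i α, α.Nonempty → distInt (f i (S.union α)) < ε := by
  obtain ⟨δ, hδ0, hδ⟩ : ∃ δ > 0, δ < min ε (1 / 2 ^ (D + 1)) :=
    exists_between (lt_min hε (by positivity))
  have hδD : 2 ^ (D + 1) * δ < 1 := by
    have := hδ.trans_le (min_le_right _ _)
    rwa [lt_div_iff₀' (by positivity)] at this
  induction k generalizing s with
  | zero => exact ⟨s, fun f _ => ⟨.ofInjective id Function.injective_id, fun i => i.elim0⟩⟩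
  | succ k ih =>
    obtain ⟨r₁, hr₁⟩ := exists_blockSystem_isNearIntPolyAddInt hδ0 hδD D le_rfl s
    obtain ⟨r, hr⟩ := ih r₁
    refine ⟨r, fun f hf => ?_⟩
    obtain ⟨S, hS⟩ := hr (fun i => f i.castSucc) fun i => hf _
    obtain ⟨d, hd, hfd⟩ := hf (Fin.last k)
    obtain ⟨T, hT⟩ := hr₁ d _ hd (hfd.comp_union S)
    refine ⟨S.comp T, fun i α hα => ?_⟩
    rw [S.comp_union]
    refine Fin.lastCases ?_ (fun i => ?_) i
    · exact (hT.distInt_le hα).trans_lt (hδ.trans_le (min_le_left _ _))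
    · exact hS i _ (T.union_nonempty hα)

theorem exists_nonempty_distInt_lt (D k : ℕ) {ε : ℝ} (hε : 0 < ε) :
    ∃ r : ℕ, ∀ f : Fin k → Finset (Fin r) → ℝ, (∀ i, ∃ d ≤ D, IsGenPoly d (f i)) →
      ∃ α : Finset (Fin r), α.Nonempty ∧ ∀ i, distInt (f i α) < ε := by
  obtain ⟨r, hr⟩ := exists_blockSystem_distInt_lt D k 1 hε
  refine ⟨r, fun f hf => ?_⟩
  obtain ⟨S, hS⟩ := hr f hf
  exact ⟨S.union {0}, S.union_nonempty (by simp), fun i => hS i _ (by simp)⟩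

end GenPoly

theorem mainTheorem4 :
    (∀ (D : ℕ) (ε : ℝ), 0 < ε → ∃ r : ℕ, ∀ φ : Finset (Fin r) → ℝ,
      GenPoly.IsOpenConstantFreeOfTotalDegreeLE D φ →
        ∃ α : Finset (Fin r), α.Nonempty ∧ GenPoly.distInt (φ α) < ε) ∧
    (∀ (k d h w : ℕ) (ε : ℝ), 0 < ε → ∃ r : ℕ, ∀ φ : Fin k → Finset (Fin r) → ℝ,
      (∀ i, GenPoly.IsGPolZero d h w (φ i)) →
        ∃ α : Finset (Fin r), α.Nonempty ∧ ∀ i, GenPoly.distInt (φ i α) < ε) := by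
  constructor
  · intro D ε hε
    obtain ⟨r, hr⟩ := GenPoly.exists_nonempty_distInt_lt D 1 hε
    refine ⟨r, fun φ hφ => ?_⟩
    obtain ⟨e, rfl, hcf, -, hdeg⟩ := hφ
    obtain ⟨α, hα, h⟩ := hr (fun _ => e.eval) fun _ => ⟨_, hdeg, e.isGenPoly hcf⟩
    exact ⟨α, hα, h 0⟩
  · intro k d h w ε hε
    obtain ⟨r, hr⟩ := GenPoly.exists_nonempty_distInt_lt (GenPoly.totalDegreeBound d w h) k hε
    exact ⟨r, fun φ hφ => hr φ fun i => (hφ i).exists_isGenPoly⟩
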